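/- For maps $n:\mathbb{R}^2\to S^2\subset\mathbb{R}^3$ and $r>0$ let $$E_4[n]=\frac12\int_{\mathbb{R}^2}|\nabla n|^2\,dx+r\int_{\mathbb{R}^2}(n-e_3)\cdot(\nabla\times n)\,dx+\frac18\int_{\mathbb{R}^2}|n-e_3|^4\,dx,$$ where $e_3=(0,0,1)$ and $\nabla\times n=(\partial_1,\partial_2,0)^T\times n$, the derivatives being weak derivatives. Let $\mathcal{M}_4$ be the space of all $n:\mathbb{R}^2\to S^2$ with $\int|\nabla n|^2+\int|n-e_3|^4<\infty$ (maps equal almost everywhere being identified), with the metric $d(n,m)=\|n-m\|_{L^4(\mathbb{R}^2)}+\|\nabla(n-m)\|_{L^2(\mathbb{R}^2)}$. Let $$h(x)=\left(\frac{-2x_2}{1+|x|^2},\ \frac{2x_1}{1+|x|^2},\ -\frac{1-|x|^2}{1+|x|^2}\right),\qquad h^{2r}(x)=h\!\left(\frac{x}{2r}\right).$$ **Theorem.** Let $r>1$. Then $h^{2r}\in\mathcal{M}_4$ is a critical point of $E_4$, that is, $\frac{d}{dt}\big|_{t=0}E_4\!\left[\frac{h^{2r}+t\varphi}{|h^{2r}+t\varphi|}\right]=0$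 for every $\varphi\in C_c^\infty(\mathbb{R}^2;\mathbb{R}^3)$, and it is unstable: every neighborhood of $h^{2r}$ in $\mathcal{M}_4$ contains some $n\in\mathcal{M}_4$ with $E_4[n]-E_4[h^{2r}]<0$. -/

import Mathlib

open MeasureTheory Topology
open scoped ContDiff

noncomputable section

/-- The plane `ℝ²`, with its Euclidean norm. -/
abbrev Plane : Type := EuclideanSpace ℝ (Fin 2)

/-- The space `ℝ³`, with its Euclidean norm. -/
abbrev Space3 : Type := EuclideanSpace ℝ (Fin 3)

/-- Values of gradients of maps `ℝ² → ℝ³`: the pair `(∂₁n, ∂₂n)`, normed by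
`|∇n|² = |∂₁n|² + |∂₂n|²`. -/
abbrev Grad : Type := PiLp 2 (fun _ : Fin 2 => Space3)

/-- The unit vector `e₃` of `ℝ³`. -/
def e3 : Space3 := !₂[0, 0, 1]

/-- `G` is a weak (distributional) gradient of `n`: both are locally integrable and
`∫ (∂ᵢφ) n = - ∫ φ Gᵢ` for every test function `φ ∈ C_c^∞(ℝ²)` and `i = 1, 2`. -/
def HasWeakGradient (n : Plane → Space3) (G : Plane → Grad) : Prop :=
  LocallyIntegrable n volume ∧ LocallyIntegrable G volume ∧
    ∀ φ : Plane → ℝ, ContDiff ℝ ∞ φ → HasCompactSupport φ → ∀ i : Fin 2,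
      ∫ x, (fderiv ℝ φ x (EuclideanSpace.single i 1)) • n x = - ∫ x, φ x • G x i

open Classical in
/-- The weak gradient `∇n = (∂₁n, ∂₂n)` of a weakly differentiable map; it is determined up to
a null set. (The value `0` is a convention for maps that are not weakly differentiable.) -/
def weakGrad (n : Plane → Space3) : Plane → Grad :=
  if h : ∃ G, HasWeakGradient n G then h.choose else 0

/-- `∇ × n = (∂₁, ∂₂, 0)ᵀ × n`; here `weakGrad n x i k` is `∂ᵢ₊₁ nₖ₊₁ (x)`. -/
def curl (n : Plane → Space3) (x : Plane) : Space3 :=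
  !₂[weakGrad n x 1 2, - weakGrad n x 0 2, weakGrad n x 0 1 - weakGrad n x 1 0]

/-- The Dirichlet energy `D[n] = ½ ∫ |∇n|²`. -/
def dirichletEnergy (n : Plane → Space3) : ℝ := (1 / 2) * ∫ x, ‖weakGrad n x‖ ^ 2

/-- The helicity `H[n] = ∫ (n - e₃) · (∇ × n)`. -/
def helicity (n : Plane → Space3) : ℝ := ∫ x, inner ℝ (n x - e3) (curl n x)

/-- The potential energy `V₄[n] = 2⁻³ ∫ |n - e₃|⁴`. -/
def potentialEnergy (n : Plane → Space3) : ℝ := (1 / 2 ^ 3) * ∫ x, ‖n x - e3‖ ^ 4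

/-- The Landau–Lifshitz energy `E₄[n] = D[n] + r H[n] + V₄[n]`. -/
def energy (r : ℝ) (n : Plane → Space3) : ℝ :=
  dirichletEnergy n + r * helicity n + potentialEnergy n

/-- The space `M₄` of weakly differentiable maps `n : ℝ² → S²` with `D[n] + V₄[n] < ∞`, i.e. with
`∇n ∈ L²` and `n - e₃ ∈ L⁴`. -/
structure M4 : Type where
  map : Plane → Space3
  norm_eq_one : ∀ x, ‖map x‖ = 1
  weaklyDiff : ∃ G, HasWeakGradient map G
  memLp_grad : MemLp (weakGrad map) 2 volume
  memLp_sub_e3 : MemLp (fun x => map x - e3) 4 volume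

theorem M4.memLp_sub (n m : M4) : MemLp (n.map - m.map) 4 volume := by
  have h := n.memLp_sub_e3.sub m.memLp_sub_e3
  have e : (fun x => n.map x - e3) - (fun x => m.map x - e3) = n.map - m.map := by
    funext x; simp
  rwa [e] at h

theorem M4.memLp_grad_sub (n m : M4) : MemLp (weakGrad n.map - weakGrad m.map) 2 volume :=
  n.memLp_grad.sub m.memLp_grad

/-- The distance `d(n, m) = ‖n - m‖_{L⁴} + ‖∇n - ∇m‖_{L²}` of `M₄`. It vanishes exactly when
`n = m` almost everywhere, so that on maps modulo null sets it is a metric. -/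
instance M4.pseudoMetricSpace : PseudoMetricSpace M4 where
  dist n m := (eLpNorm (n.map - m.map) 4 volume).toReal +
    (eLpNorm (weakGrad n.map - weakGrad m.map) 2 volume).toReal
  dist_self n := by simp
  dist_comm n m := by
    rw [eLpNorm_sub_comm n.map m.map, eLpNorm_sub_comm (weakGrad n.map) (weakGrad m.map)]
  dist_triangle a b c := by
    have h1 : (eLpNorm (a.map - c.map) 4 volume).toReal ≤
        (eLpNorm (a.map - b.map) 4 volume).toReal + (eLpNorm (b.map - c.map) 4 volume).toReal := by
      have hab := M4.memLp_sub a b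
      have hbc := M4.memLp_sub b c
      rw [← ENNReal.toReal_add hab.2.ne hbc.2.ne]
      refine ENNReal.toReal_mono (ENNReal.add_ne_top.2 ⟨hab.2.ne, hbc.2.ne⟩) ?_
      have h := eLpNorm_add_le hab.1 hbc.1 (p := 4) (by norm_num)
      rwa [sub_add_sub_cancel] at h
    have h2 : (eLpNorm (weakGrad a.map - weakGrad c.map) 2 volume).toReal ≤
        (eLpNorm (weakGrad a.map - weakGrad b.map) 2 volume).toReal +
          (eLpNorm (weakGrad b.map - weakGrad c.map) 2 volume).toReal := by
      have hab := M4.memLp_grad_sub a b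
      have hbc := M4.memLp_grad_sub b c
      rw [← ENNReal.toReal_add hab.2.ne hbc.2.ne]
      refine ENNReal.toReal_mono (ENNReal.add_ne_top.2 ⟨hab.2.ne, hbc.2.ne⟩) ?_
      have h := eLpNorm_add_le hab.1 hbc.1 (p := 2) (by norm_num)
      rwa [sub_add_sub_cancel] at h
    linarith

/-- `n` is a critical point of `E₄`: the first variation vanishes, `d/dt E₄[n_t] = 0` at `t = 0`,
for all variations `n_t = (n + tφ) / |n + tφ|` within sphere-valued maps, `φ ∈ C_c^∞(ℝ²; ℝ³)`. -/
def IsCriticalPoint (r : ℝ) (n : Plane → Space3) : Prop :=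
  ∀ φ : Plane → Space3, ContDiff ℝ ∞ φ → HasCompactSupport φ →
    HasDerivAt (fun t : ℝ => energy r (fun x => ‖n x + t • φ x‖⁻¹ • (n x + t • φ x))) 0 0

/-- The map `h(x) = (-2x₂, 2x₁, |x|² - 1) / (1 + |x|²)`. -/
def hMap (x : Plane) : Space3 :=
  !₂[-2 * x 1 / (1 + ‖x‖ ^ 2), 2 * x 0 / (1 + ‖x‖ ^ 2), -((1 - ‖x‖ ^ 2) / (1 + ‖x‖ ^ 2))]

/-- The rescaled map `h^s(x) = h(x / s)`. -/
def skyrmion (s : ℝ) (x : Plane) : Space3 := hMap (s⁻¹ • x)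

end

/-!
Write `q = (1 + a² x₁² + b² x₂²)⁻¹` and consider the maps `n(x) = h(a x₁, b x₂)`, of which the
skyrmion `h^{2r}` is the case `a = b = s := 1 / (2r)`. For them `|∇n|² = 4 (a² + b²) q²`,
`(n - e₃) · (∇ × n) = -4 (a + b) q²` and `|n - e₃|⁴ = 16 q²`, so that, with `J = ∫ (1 + |x|²)⁻² > 0`,
`E₄[n] = J (2 (a² + b²) - 4 r (a + b) + 2) / (a b)` (`energy_ellipticMap`).

*Instability.* For `a = s + δ`, `b = s - δ` this equals `2 J (-2 + (4 s² - 1) / (s² - δ²))`, which is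
strictly below its value at `δ = 0` since `2 s = 1 / r < 1` (`energy_ellipticMap_lt`). As `δ → 0`
these maps tend to the skyrmion in `M₄`, by dominated convergence (`tendsto_ellipticM4`).

*Criticality.* The density of `E₄` is a polynomial of degree four in `n` and `∇n`. The skyrmion
satisfies `Δn = -|∇n|² n` and `2 r ∇ × n = -½ |n - e₃|² (n - e₃)`, whence the part of the energy
change that is linear in a compactly supported change `u` of `n` is a divergence plus `|∇n|² n · u`
(`firstVariation_skyrmion`). If `n + u` is again sphere-valued then `n · u = -½ |u|²`, and so
`|E₄[n + u] - E₄[n]| ≤ C ∫ (|u|² + |∇u|²)` (`abs_energy_add_sub_le`). In a variation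
`n_t = (n + tφ) / |n + tφ|` the change `n_t - n` and its gradient are `O(t)` uniformly
(`exists_variationChange_le`), so that `E₄[n_t] - E₄[n] = O(t²)` and the derivative at `0` vanishes.
All maps involved are smooth; their weak gradients agree almost everywhere with the classical ones
(`weakGrad_ae_eq`).
-/

open Filter

noncomputable section

/-! ### Weak gradients of continuously differentiable maps -/

/-- The classical gradient `(∂₁n, ∂₂n)`, packaged as a value of `Grad`. -/
def classicalGrad (n : Plane → Space3) (x : Plane) : Grad :=
  WithLp.toLp 2 fun i => fderiv ℝ n x (EuclideanSpace.single i 1)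

theorem classicalGrad_apply (n : Plane → Space3) (x : Plane) (i : Fin 2) :
    classicalGrad n x i = fderiv ℝ n x (EuclideanSpace.single i 1) := rfl

theorem continuous_classicalGrad {n : Plane → Space3} (hn : ContDiff ℝ 1 n) :
    Continuous (classicalGrad n) := by
  have := hn.continuous_fderiv one_ne_zero
  unfold classicalGrad
  fun_prop

theorem hasWeakGradient_classicalGrad {n : Plane → Space3} (hn : ContDiff ℝ 1 n) :
    HasWeakGradient n (classicalGrad n) := by
  refine ⟨hn.continuous.locallyIntegrable, (continuous_classicalGrad hn).locallyIntegrable, ?_⟩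
  intro φ hφ hc i
  have hφ' := hφ.continuous_fderiv (by simp)
  have hn' := hn.continuous_fderiv one_ne_zero
  have hnc := hn.continuous
  have hφc := hφ.continuous
  have hc' : HasCompactSupport fun x => fderiv ℝ φ x (EuclideanSpace.single i 1) :=
    hc.fderiv_apply ℝ _
  simp only [classicalGrad_apply]
  rw [integral_smul_fderiv_eq_neg_fderiv_smul_of_integrable _ _ _
    (fun _ _ => hφ.differentiable (by simp) _) (fun _ _ => hn.differentiable one_ne_zero _), neg_neg]
  · exact Continuous.integrable_of_hasCompactSupport (by fun_prop) (hc'.smul_right)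
  · exact Continuous.integrable_of_hasCompactSupport (by fun_prop) (hc.smul_right)
  · exact Continuous.integrable_of_hasCompactSupport (by fun_prop) (hc.smul_right)

theorem HasWeakGradient.ae_eq {n : Plane → Space3} {G G' : Plane → Grad}
    (h : HasWeakGradient n G) (h' : HasWeakGradient n G') : G =ᵐ[volume] G' := by
  have key : ∀ i : Fin 2, ∀ᵐ x, G x i = G' x i := by
    intro i
    have hl : ∀ {F : Plane → Grad}, LocallyIntegrable F volume →
        LocallyIntegrable (fun x => F x i) volume := by
      intro F hF x
      obtain ⟨s, hs, hi⟩ := hF x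
      exact ⟨s, hs, (PiLp.proj (𝕜 := ℝ) 2 (fun _ : Fin 2 => Space3) i).integrable_comp hi⟩
    refine ae_eq_of_integral_contDiff_smul_eq (hl h.2.1) (hl h'.2.1) fun g hg hc => ?_
    rw [← neg_inj, ← h.2.2 g hg hc i, ← h'.2.2 g hg hc i]
  filter_upwards [ae_all_iff.2 key] with x hx
  ext i : 1
  exact hx i

theorem weakGrad_ae_eq {n : Plane → Space3} (hn : ContDiff ℝ 1 n) :
    weakGrad n =ᵐ[volume] classicalGrad n := by
  have h : ∃ G, HasWeakGradient n G := ⟨_, hasWeakGradient_classicalGrad hn⟩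
  have hw : HasWeakGradient n (weakGrad n) := by
    rw [weakGrad, dif_pos h]
    exact h.choose_spec
  exact hw.ae_eq (hasWeakGradient_classicalGrad hn)

/-- The bilinear form `w · (∂₁, ∂₂, 0)ᵀ × n` in a vector `w` and a gradient `G = ∇n`; the helicity
density is its value at `w = n - e₃`. -/
def helicityForm (w : Space3) (G : Grad) : ℝ :=
  w 0 * G 1 2 - w 1 * G 0 2 + w 2 * (G 0 1 - G 1 0)

/-- The density of `E₄`, as a function of the values `v = n(x)` and `G = ∇n(x)`. -/
def energyDensity (r : ℝ) (v : Space3) (G : Grad) : ℝ :=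
  (1 / 2) * ‖G‖ ^ 2 + r * helicityForm (v - e3) G + (1 / 2 ^ 3) * ‖v - e3‖ ^ 4

theorem energy_eq_integral {r : ℝ} {n : Plane → Space3} (hn : ContDiff ℝ 1 n)
    (hD : Integrable fun x => ‖classicalGrad n x‖ ^ 2)
    (hH : Integrable fun x => helicityForm (n x - e3) (classicalGrad n x))
    (hV : Integrable fun x => ‖n x - e3‖ ^ 4) :
    energy r n = ∫ x, energyDensity r (n x) (classicalGrad n x) := by
  have h1 : ∫ x, ‖weakGrad n x‖ ^ 2 = ∫ x, ‖classicalGrad n x‖ ^ 2 := by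
    refine integral_congr_ae ?_
    filter_upwards [weakGrad_ae_eq hn] with x hx
    rw [hx]
  have h2 : helicity n = ∫ x, helicityForm (n x - e3) (classicalGrad n x) := by
    refine integral_congr_ae ?_
    filter_upwards [weakGrad_ae_eq hn] with x hx
    simp [curl, hx, helicityForm, PiLp.inner_apply, Fin.sum_univ_three, e3]
    ring
  have h3 : Integrable fun x => 1 / 2 * ‖classicalGrad n x‖ ^ 2 +
      r * helicityForm (n x - e3) (classicalGrad n x) := (hD.const_mul _).add (hH.const_mul _)
  simp only [energyDensity]
  rw [integral_add h3 (hV.const_mul _),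
    integral_add (hD.const_mul _) (hH.const_mul _), integral_const_mul, integral_const_mul,
    integral_const_mul, energy, dirichletEnergy, potentialEnergy, h1, h2]

/-! ### The skyrmion and its diagonal deformations -/

/-- The function `(1 + a² x₁² + b² x₂²)⁻¹`. -/
def ellipticBump (a b : ℝ) (x : Plane) : ℝ := (1 + a ^ 2 * x 0 ^ 2 + b ^ 2 * x 1 ^ 2)⁻¹

/-- The map `x ↦ h(a x₁, b x₂)`, the skyrmion deformed by a diagonal linear map. -/
def ellipticMap (a b : ℝ) (x : Plane) : Space3 :=
  !₂[-2 * b * x 1 * ellipticBump a b x, 2 * a * x 0 * ellipticBump a b x,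
    1 - 2 * ellipticBump a b x]

theorem ellipticBump_pos (a b : ℝ) (x : Plane) : 0 < ellipticBump a b x := by
  unfold ellipticBump
  positivity

theorem ellipticBump_mul (a b : ℝ) (x : Plane) :
    ellipticBump a b x * (1 + a ^ 2 * x 0 ^ 2 + b ^ 2 * x 1 ^ 2) = 1 :=
  inv_mul_cancel₀ (by positivity)

@[fun_prop]
theorem contDiff_ellipticBump (a b : ℝ) : ContDiff ℝ ∞ (ellipticBump a b) := by
  unfold ellipticBump
  refine ContDiff.inv (by fun_prop) fun x => by positivity

@[fun_prop]
theorem differentiable_ellipticBump (a b : ℝ) : Differentiable ℝ (ellipticBump a b) :=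
  (contDiff_ellipticBump a b).differentiable (by simp)

@[fun_prop]
theorem continuous_ellipticBump (a b : ℝ) : Continuous (ellipticBump a b) :=
  (contDiff_ellipticBump a b).continuous

theorem contDiff_ellipticMap (a b : ℝ) : ContDiff ℝ ∞ (ellipticMap a b) := by
  rw [contDiff_euclidean]
  intro i
  fin_cases i <;> simp [ellipticMap] <;> fun_prop

theorem fderiv_coord (x v : Plane) (i : Fin 2) : fderiv ℝ (fun y : Plane => y i) x v = v i :=
  congrArg (fun L : Plane →L[ℝ] ℝ => L v)
    (EuclideanSpace.proj (𝕜 := ℝ) (ι := Fin 2) i).fderiv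

theorem fderiv_ellipticBump (a b : ℝ) (x v : Plane) :
    fderiv ℝ (ellipticBump a b) x v =
      -2 * ellipticBump a b x ^ 2 * (a ^ 2 * x 0 * v 0 + b ^ 2 * x 1 * v 1) := by
  have hf : DifferentiableAt ℝ
    (fun y : Plane => 1 + a ^ 2 * y 0 ^ 2 + b ^ 2 * y 1 ^ 2) x := by fun_prop
  have h := ((hasDerivAt_inv (x := 1 + a ^ 2 * x 0 ^ 2 + b ^ 2 * x 1 ^ 2)
    (by positivity)).comp_hasFDerivAt x hf.hasFDerivAt).fderiv
  change fderiv ℝ (ellipticBump a b) x = _ at h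
  rw [h, ellipticBump]
  simp (disch := fun_prop) [fderiv_fun_add, fderiv_const_mul, fderiv_fun_pow, fderiv_coord]
  ring

theorem fderiv_space3_apply {n : Plane → Space3} {x : Plane} (hn : DifferentiableAt ℝ n x)
    (v : Plane) (k : Fin 3) : fderiv ℝ n x v k = fderiv ℝ (fun y => n y k) x v := by
  have h := ((EuclideanSpace.proj (𝕜 := ℝ) (ι := Fin 3) k).hasFDerivAt.comp x
    hn.hasFDerivAt).fderiv
  exact (congrArg (fun L : Plane →L[ℝ] ℝ => L v) h).symm

theorem fderiv_ellipticMap (a b : ℝ) (x v : Plane) :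
    fderiv ℝ (ellipticMap a b) x v =
      !₂[-2 * b * v 1 * ellipticBump a b x + 4 * b * x 1 * ellipticBump a b x ^ 2 *
          (a ^ 2 * x 0 * v 0 + b ^ 2 * x 1 * v 1),
        2 * a * v 0 * ellipticBump a b x - 4 * a * x 0 * ellipticBump a b x ^ 2 *
          (a ^ 2 * x 0 * v 0 + b ^ 2 * x 1 * v 1),
        4 * ellipticBump a b x ^ 2 * (a ^ 2 * x 0 * v 0 + b ^ 2 * x 1 * v 1)] := by
  ext k
  rw [fderiv_space3_apply ((contDiff_ellipticMap a b).differentiable (by simp) x)]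
  fin_cases k <;>
  · simp (disch := fun_prop) [ellipticMap, fderiv_fun_mul, fderiv_coord,
      fderiv_fun_sub, fderiv_ellipticBump]
    ring

theorem norm_ellipticMap (a b : ℝ) (x : Plane) : ‖ellipticMap a b x‖ = 1 := by
  have h := ellipticBump_mul a b x
  rw [← sq_eq_sq₀ (norm_nonneg _) one_pos.le, EuclideanSpace.real_norm_sq_eq]
  simp [Fin.sum_univ_three, ellipticMap]
  linear_combination 4 * ellipticBump a b x * h

theorem norm_ellipticMap_sub_e3 (a b : ℝ) (x : Plane) :
    ‖ellipticMap a b x - e3‖ ^ 2 = 4 * ellipticBump a b x := by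
  have h := ellipticBump_mul a b x
  rw [EuclideanSpace.real_norm_sq_eq]
  simp [Fin.sum_univ_three, ellipticMap, e3]
  linear_combination 4 * ellipticBump a b x * h

theorem norm_classicalGrad_ellipticMap (a b : ℝ) (x : Plane) :
    ‖classicalGrad (ellipticMap a b) x‖ ^ 2 = 4 * (a ^ 2 + b ^ 2) * ellipticBump a b x ^ 2 := by
  have h := ellipticBump_mul a b x
  rw [PiLp.norm_sq_eq_of_L2]
  simp only [EuclideanSpace.real_norm_sq_eq, classicalGrad_apply, fderiv_ellipticMap]
  simp [Fin.sum_univ_three, Fin.sum_univ_two]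
  generalize ellipticBump a b x = q at *
  linear_combination (16 * q ^ 3 * (a ^ 4 * x 0 ^ 2 + b ^ 4 * x 1 ^ 2)) * h

theorem helicityForm_ellipticMap (a b : ℝ) (x : Plane) :
    helicityForm (ellipticMap a b x - e3) (classicalGrad (ellipticMap a b) x) =
      -4 * (a + b) * ellipticBump a b x ^ 2 := by
  simp only [helicityForm, classicalGrad_apply, fderiv_ellipticMap]
  simp [ellipticMap, e3]
  ring

/-! ### Energies of the deformed maps, and instability -/

theorem ellipticBump_le {m a b : ℝ} (hm : 0 < m) (ha : m ≤ a) (hb : m ≤ b) (x : Plane) :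
    ellipticBump a b x ≤ (1 + (m ^ 2)⁻¹) * ellipticBump 1 1 x := by
  unfold ellipticBump
  rw [← div_eq_mul_inv, inv_eq_one_div, div_le_div_iff₀ (by positivity) (by positivity)]
  have h1 : x 0 ^ 2 ≤ (m ^ 2)⁻¹ * (a ^ 2 * x 0 ^ 2) := by
    rw [← div_eq_inv_mul, le_div_iff₀ (by positivity), mul_comm]
    gcongr
  have h2 : x 1 ^ 2 ≤ (m ^ 2)⁻¹ * (b ^ 2 * x 1 ^ 2) := by
    rw [← div_eq_inv_mul, le_div_iff₀ (by positivity), mul_comm]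
    gcongr
  have h3 : 0 < (m ^ 2)⁻¹ := by positivity
  nlinarith [sq_nonneg (a * x 0), sq_nonneg (b * x 1)]

theorem integrable_ellipticBump_one_sq :
    Integrable fun x : Plane => ellipticBump 1 1 x ^ 2 := by
  refine (integrable_rpow_neg_one_add_norm_sq (E := Plane) (r := 4) (by simp; norm_num)).congr ?_
  refine .of_forall fun x => ?_
  have h : 0 ≤ 1 + ‖x‖ ^ 2 := by positivity
  beta_reduce
  rw [show (-4 / 2 : ℝ) = -((2 : ℕ) : ℝ) by norm_num, Real.rpow_neg h, Real.rpow_natCast]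
  simp [ellipticBump, EuclideanSpace.real_norm_sq_eq, Fin.sum_univ_two, add_assoc]

theorem integrable_ellipticBump_sq {a b : ℝ} (ha : 0 < a) (hb : 0 < b) :
    Integrable fun x : Plane => ellipticBump a b x ^ 2 := by
  refine (integrable_ellipticBump_one_sq.const_mul ((1 + ((min a b) ^ 2)⁻¹) ^ 2)).mono'
    (by fun_prop) (.of_forall fun x => ?_)
  rw [Real.norm_of_nonneg (by positivity), ← mul_pow]
  have := ellipticBump_pos a b x
  gcongr
  exact ellipticBump_le (lt_min ha hb) (min_le_left _ _) (min_le_right _ _) x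

/-- The integral of `(1 + |x|²)⁻²` over the plane (its value is `π`; only positivity matters). -/
def bumpIntegral : ℝ := ∫ x : Plane, ellipticBump 1 1 x ^ 2

theorem bumpIntegral_pos : 0 < bumpIntegral := by
  unfold bumpIntegral
  rw [integral_pos_iff_support_of_nonneg (fun x => by positivity) integrable_ellipticBump_one_sq]
  have : Function.support (fun x : Plane => ellipticBump 1 1 x ^ 2) = Set.univ := by
    ext x
    simp [(ellipticBump_pos 1 1 x).ne']
  simp [this]

theorem integral_ellipticBump_sq {a b : ℝ} (ha : 0 < a) (hb : 0 < b) :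
    ∫ x : Plane, ellipticBump a b x ^ 2 = bumpIntegral / (a * b) := by
  let L : Plane →ₗ[ℝ] Plane := Matrix.toLpLin 2 2 (Matrix.diagonal ![a, b])
  have hdet : LinearMap.det L = a * b := by
    simp [L, Matrix.toLpLin_eq_toLin, LinearMap.det_toLin, Matrix.det_diagonal]
  have hL : ∀ x, ellipticBump 1 1 (L x) = ellipticBump a b x := by
    intro x
    simp [L, ellipticBump, Matrix.toLpLin_apply, mul_pow]
  have hc : Continuous L := L.continuous_of_finiteDimensional
  have hab : 0 < a * b := by positivity
  have h := Measure.map_linearMap_addHaar_eq_smul_addHaar (volume : Measure Plane)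
    (f := L) (by rw [hdet]; exact hab.ne')
  simp_rw [← hL]
  rw [← integral_map (φ := L) (f := fun y => ellipticBump 1 1 y ^ 2) hc.aemeasurable
    (by fun_prop), h, integral_smul_measure, hdet, ENNReal.toReal_ofReal (by positivity),
    abs_of_pos (by positivity), bumpIntegral, smul_eq_mul, div_eq_inv_mul]

theorem integrable_norm_classicalGrad_ellipticMap {a b : ℝ} (ha : 0 < a) (hb : 0 < b) :
    Integrable fun x => ‖classicalGrad (ellipticMap a b) x‖ ^ 2 := by
  simp_rw [norm_classicalGrad_ellipticMap]
  exact (integrable_ellipticBump_sq ha hb).const_mul _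

theorem integrable_helicityForm_ellipticMap {a b : ℝ} (ha : 0 < a) (hb : 0 < b) :
    Integrable fun x => helicityForm (ellipticMap a b x - e3)
      (classicalGrad (ellipticMap a b) x) := by
  simp_rw [helicityForm_ellipticMap]
  exact (integrable_ellipticBump_sq ha hb).const_mul _

theorem norm_ellipticMap_sub_e3_pow_four (a b : ℝ) (x : Plane) :
    ‖ellipticMap a b x - e3‖ ^ 4 = 16 * ellipticBump a b x ^ 2 := by
  rw [show 4 = 2 * 2 from rfl, pow_mul, norm_ellipticMap_sub_e3]
  ring

theorem integrable_norm_ellipticMap_sub_e3 {a b : ℝ} (ha : 0 < a) (hb : 0 < b) :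
    Integrable fun x => ‖ellipticMap a b x - e3‖ ^ 4 := by
  simp_rw [norm_ellipticMap_sub_e3_pow_four]
  exact (integrable_ellipticBump_sq ha hb).const_mul _

theorem energy_ellipticMap (r : ℝ) {a b : ℝ} (ha : 0 < a) (hb : 0 < b) :
    energy r (ellipticMap a b) =
      bumpIntegral * (2 * (a ^ 2 + b ^ 2) - 4 * r * (a + b) + 2) / (a * b) := by
  rw [energy_eq_integral ((contDiff_ellipticMap a b).of_le (by simp))
    (integrable_norm_classicalGrad_ellipticMap ha hb)
    (integrable_helicityForm_ellipticMap ha hb) (integrable_norm_ellipticMap_sub_e3 ha hb)]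
  simp_rw [energyDensity, norm_classicalGrad_ellipticMap, helicityForm_ellipticMap,
    norm_ellipticMap_sub_e3_pow_four]
  have : ∀ x : Plane, 1 / 2 * (4 * (a ^ 2 + b ^ 2) * ellipticBump a b x ^ 2) +
      r * (-4 * (a + b) * ellipticBump a b x ^ 2) + 1 / 2 ^ 3 * (16 * ellipticBump a b x ^ 2) =
      (2 * (a ^ 2 + b ^ 2) - 4 * r * (a + b) + 2) * ellipticBump a b x ^ 2 := fun x => by ring
  simp_rw [this]
  rw [integral_const_mul, integral_ellipticBump_sq ha hb]
  ring

theorem skyrmion_eq_ellipticMap (s : ℝ) : skyrmion s = ellipticMap s⁻¹ s⁻¹ := by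
  funext x
  have h : 1 + ‖s⁻¹ • x‖ ^ 2 = (ellipticBump s⁻¹ s⁻¹ x)⁻¹ := by
    rw [EuclideanSpace.real_norm_sq_eq, ellipticBump, inv_inv]
    simp [Fin.sum_univ_two]
    ring
  have h' : 1 - ‖s⁻¹ • x‖ ^ 2 = 2 - (ellipticBump s⁻¹ s⁻¹ x)⁻¹ := by linear_combination -h
  have hq := (ellipticBump_pos s⁻¹ s⁻¹ x).ne'
  simp only [skyrmion, hMap, h, h']
  ext k
  fin_cases k <;> simp [ellipticMap]
  · exact .inl (by ring)
  · exact .inl (by ring)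
  · linear_combination mul_inv_cancel₀ hq

theorem memLp_natCast_of_integrable_pow {E : Type*} [NormedAddCommGroup E] {f : Plane → E} {p : ℕ}
    (hp : p ≠ 0) (hf : AEStronglyMeasurable f volume) (hi : Integrable fun x => ‖f x‖ ^ p) :
    MemLp f p volume := by
  rw [← integrable_norm_rpow_iff hf (by simpa using hp) (by simp)]
  simpa using hi

theorem tendsto_eLpNorm_of_dominated {E : Type*} [NormedAddCommGroup E] {f : ℕ → Plane → E}
    {g : Plane → ℝ} {p : ℕ} (hp : p ≠ 0) (hf : ∀ k, AEStronglyMeasurable (f k) volume)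
    (hg : Integrable g) (hb : ∀ k x, ‖f k x‖ ^ p ≤ g x)
    (hlim : ∀ x, Tendsto (fun k => f k x) atTop (𝓝 0)) :
    Tendsto (fun k => (eLpNorm (f k) p volume).toReal) atTop (𝓝 0) := by
  have h1 : Tendsto (fun k => ∫ x, ‖f k x‖ ^ p) atTop (𝓝 0) := by
    have := tendsto_integral_of_dominated_convergence (F := fun k x => ‖f k x‖ ^ p)
      (f := fun _ => (0 : ℝ)) g (fun k => ((hf k).norm.pow p)) hg
      (fun k => .of_forall fun x => by
        rw [Real.norm_of_nonneg (by positivity)]; exact hb k x)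
      (.of_forall fun x => by simpa [hp] using ((hlim x).norm.pow p))
    simpa using this
  have hp' : (0 : ℝ) < (p : ℝ)⁻¹ := by positivity
  have h2 := h1.rpow_const (p := (p : ℝ)⁻¹) (.inr hp'.le)
  rw [Real.zero_rpow hp'.ne'] at h2
  refine h2.congr fun k => ?_
  have hm : MemLp (f k) p volume := by
    refine memLp_natCast_of_integrable_pow hp (hf k) (hg.mono' ((hf k).norm.pow p) ?_)
    exact .of_forall fun x => by rw [Real.norm_of_nonneg (by positivity)]; exact hb k x
  rw [hm.eLpNorm_eq_integral_rpow_norm (by simpa using hp) (by simp),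
    ENNReal.toReal_ofReal (by positivity)]
  simp

/-- The deformed skyrmion, as an element of `M₄`. -/
def ellipticM4 {a b : ℝ} (ha : 0 < a) (hb : 0 < b) : M4 where
  map := ellipticMap a b
  norm_eq_one := norm_ellipticMap a b
  weaklyDiff := ⟨_, hasWeakGradient_classicalGrad ((contDiff_ellipticMap a b).of_le (by simp))⟩
  memLp_grad := by
    have hn : ContDiff ℝ 1 (ellipticMap a b) := (contDiff_ellipticMap a b).of_le (by simp)
    rw [memLp_congr_ae (weakGrad_ae_eq hn)]
    exact memLp_natCast_of_integrable_pow (p := 2) two_ne_zero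
      (continuous_classicalGrad hn).aestronglyMeasurable
      (integrable_norm_classicalGrad_ellipticMap ha hb)
  memLp_sub_e3 := memLp_natCast_of_integrable_pow (p := 4) four_ne_zero
    ((contDiff_ellipticMap a b).continuous.sub continuous_const).aestronglyMeasurable
    (integrable_norm_ellipticMap_sub_e3 ha hb)

theorem tendsto_ellipticBump {a b : ℕ → ℝ} {s t : ℝ} (hla : Tendsto a atTop (𝓝 s))
    (hlb : Tendsto b atTop (𝓝 t)) (x : Plane) :
    Tendsto (fun k => ellipticBump (a k) (b k) x) atTop (𝓝 (ellipticBump s t x)) := by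
  unfold ellipticBump
  refine Tendsto.inv₀ ?_ (by positivity)
  exact (((hla.pow 2).mul_const _).const_add _).add ((hlb.pow 2).mul_const _)

theorem tendsto_space3 {f : ℕ → Space3} {v : Space3}
    (h : ∀ i, Tendsto (fun k => f k i) atTop (𝓝 (v i))) : Tendsto f atTop (𝓝 v) :=
  ((PiLp.continuous_toLp 2 (fun _ : Fin 3 => ℝ)).tendsto _).comp (tendsto_pi_nhds.2 h)

theorem tendsto_ellipticMap {a b : ℕ → ℝ} {s t : ℝ} (hla : Tendsto a atTop (𝓝 s))
    (hlb : Tendsto b atTop (𝓝 t)) (x : Plane) :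
    Tendsto (fun k => ellipticMap (a k) (b k) x) atTop (𝓝 (ellipticMap s t x)) := by
  have hq := tendsto_ellipticBump hla hlb x
  refine tendsto_space3 fun i => ?_
  fin_cases i
  · exact ((hlb.const_mul _).mul_const _).mul hq
  · exact ((hla.const_mul _).mul_const _).mul hq
  · exact (hq.const_mul _).const_sub _

theorem tendsto_classicalGrad_ellipticMap {a b : ℕ → ℝ} {s t : ℝ} (hla : Tendsto a atTop (𝓝 s))
    (hlb : Tendsto b atTop (𝓝 t)) (x : Plane) :
    Tendsto (fun k => classicalGrad (ellipticMap (a k) (b k)) x) atTop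
      (𝓝 (classicalGrad (ellipticMap s t) x)) := by
  have hq := tendsto_ellipticBump hla hlb x
  refine ((PiLp.continuous_toLp 2 (fun _ : Fin 2 => Space3)).tendsto _).comp
    (tendsto_pi_nhds.2 fun j => ?_)
  simp only [fderiv_ellipticMap]
  have hl : ∀ c d : ℝ, Tendsto (fun k => a k ^ 2 * x 0 * c + b k ^ 2 * x 1 * d) atTop
      (𝓝 (s ^ 2 * x 0 * c + t ^ 2 * x 1 * d)) := fun c d =>
    (((hla.pow 2).mul_const _).mul_const _).add (((hlb.pow 2).mul_const _).mul_const _)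
  refine tendsto_space3 fun i => ?_
  fin_cases i
  · exact (((hlb.const_mul _).mul_const _).mul hq).add
      ((((hlb.const_mul _).mul_const _).mul (hq.pow 2)).mul (hl _ _))
  · exact (((hla.const_mul _).mul_const _).mul hq).sub
      ((((hla.const_mul _).mul_const _).mul (hq.pow 2)).mul (hl _ _))
  · exact ((hq.pow 2).const_mul _).mul (hl _ _)

theorem norm_ellipticMap_sub_pow_four_le {m a b s t : ℝ} (hm : 0 < m) (ha : m ≤ a) (hb : m ≤ b)
    (hs : m ≤ s) (ht : m ≤ t) (x : Plane) :
    ‖ellipticMap a b x - ellipticMap s t x‖ ^ 4 ≤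
      256 * (1 + (m ^ 2)⁻¹) ^ 2 * ellipticBump 1 1 x ^ 2 := by
  have h1 : ‖ellipticMap a b x - ellipticMap s t x‖ ≤
      ‖ellipticMap a b x - e3‖ + ‖ellipticMap s t x - e3‖ := by
    rw [← sub_sub_sub_cancel_right _ _ e3]
    exact norm_sub_le _ _
  have h2 := (pow_le_pow_left₀ (norm_nonneg _) h1 4).trans
    (add_pow_le (norm_nonneg _) (norm_nonneg _) 4)
  rw [norm_ellipticMap_sub_e3_pow_four, norm_ellipticMap_sub_e3_pow_four] at h2
  have h3 := pow_le_pow_left₀ (ellipticBump_pos a b x).le (ellipticBump_le hm ha hb x) 2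
  have h4 := pow_le_pow_left₀ (ellipticBump_pos s t x).le (ellipticBump_le hm hs ht x) 2
  rw [mul_pow] at h3 h4
  norm_num at h2
  linarith

theorem norm_classicalGrad_ellipticMap_sub_sq_le {m M a b s t : ℝ} (hm : 0 < m) (ha : m ≤ a)
    (hb : m ≤ b) (hs : m ≤ s) (ht : m ≤ t) (ha' : a ≤ M) (hb' : b ≤ M) (hs' : s ≤ M)
    (ht' : t ≤ M) (x : Plane) :
    ‖classicalGrad (ellipticMap a b) x - classicalGrad (ellipticMap s t) x‖ ^ 2 ≤
      32 * M ^ 2 * (1 + (m ^ 2)⁻¹) ^ 2 * ellipticBump 1 1 x ^ 2 := by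
  have h2 := (pow_le_pow_left₀ (norm_nonneg _) (norm_sub_le (classicalGrad (ellipticMap a b) x)
    (classicalGrad (ellipticMap s t) x)) 2).trans
    (add_pow_le (norm_nonneg _) (norm_nonneg _) 2)
  have key : ∀ {c d : ℝ}, m ≤ c → m ≤ d → c ≤ M → d ≤ M →
      ‖classicalGrad (ellipticMap c d) x‖ ^ 2 ≤
        4 * (M ^ 2 + M ^ 2) * ((1 + (m ^ 2)⁻¹) * ellipticBump 1 1 x) ^ 2 := by
    intro c d hc hd hc' hd'
    rw [norm_classicalGrad_ellipticMap]
    have := ellipticBump_pos c d x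
    have := ellipticBump_le hm hc hd x
    have : 0 < c := hm.trans_le hc
    have : 0 < d := hm.trans_le hd
    gcongr
  have h3 := key ha hb ha' hb'
  have h4 := key hs ht hs' ht'
  rw [mul_pow] at h3 h4
  norm_num at h2
  linarith

theorem tendsto_ellipticM4 {s m M : ℝ} (hs : 0 < s) {a b : ℕ → ℝ} (ha : ∀ k, 0 < a k)
    (hb : ∀ k, 0 < b k) (hm : 0 < m) (ha' : ∀ k, a k ∈ Set.Icc m M) (hb' : ∀ k, b k ∈ Set.Icc m M)
    (hla : Tendsto a atTop (𝓝 s)) (hlb : Tendsto b atTop (𝓝 s)) :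
    Tendsto (fun k => ellipticM4 (ha k) (hb k)) atTop (𝓝 (ellipticM4 hs hs)) := by
  have hs' : s ∈ Set.Icc m M := isClosed_Icc.mem_of_tendsto hla (.of_forall ha')
  have hn : ∀ c d, ContDiff ℝ 1 (ellipticMap c d) := fun c d =>
    (contDiff_ellipticMap c d).of_le (by simp)
  rw [tendsto_iff_dist_tendsto_zero]
  have h1 := tendsto_eLpNorm_of_dominated (p := 4)
    (f := fun k => ellipticMap (a k) (b k) - ellipticMap s s) four_ne_zero
    (fun k => ((hn _ _).continuous.sub (hn _ _).continuous).aestronglyMeasurable)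
    (integrable_ellipticBump_one_sq.const_mul _)
    (fun k x => norm_ellipticMap_sub_pow_four_le hm (ha' k).1 (hb' k).1 hs'.1 hs'.1 x)
    (fun x => tendsto_sub_nhds_zero_iff.2 (tendsto_ellipticMap hla hlb x))
  have h2 := tendsto_eLpNorm_of_dominated (p := 2)
    (f := fun k => classicalGrad (ellipticMap (a k) (b k)) - classicalGrad (ellipticMap s s))
    two_ne_zero
    (fun k => ((continuous_classicalGrad (hn _ _)).sub
      (continuous_classicalGrad (hn _ _))).aestronglyMeasurable)
    (integrable_ellipticBump_one_sq.const_mul _)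
    (fun k x => norm_classicalGrad_ellipticMap_sub_sq_le hm (ha' k).1 (hb' k).1 hs'.1 hs'.1
      (ha' k).2 (hb' k).2 hs'.2 hs'.2 x)
    (fun x => tendsto_sub_nhds_zero_iff.2 (tendsto_classicalGrad_ellipticMap hla hlb x))
  have h3 := h1.add h2
  rw [add_zero] at h3
  refine h3.congr fun k => ?_
  rw [← eLpNorm_congr_ae ((weakGrad_ae_eq (hn (a k) (b k))).sub (weakGrad_ae_eq (hn s s)))]
  rfl

/-- Stretching by the factors `s + δ` and `s - δ` lowers the energy, as soon as `2s < 1`. -/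
theorem energy_ellipticMap_lt {r s δ : ℝ} (hr : 1 < r) (hs : s = (2 * r)⁻¹) (hδ : 0 < δ)
    (hδs : δ < s) :
    energy r (ellipticMap (s + δ) (s - δ)) < energy r (ellipticMap s s) := by
  have h0 : 0 < s := hδ.trans hδs
  have hrs : 2 * r * s = 1 := by rw [hs]; exact mul_inv_cancel₀ (by positivity)
  have hs1 : s < 1 / 2 := by nlinarith
  have e1 : 4 * r * (s + δ + (s - δ)) = 4 := by linear_combination 4 * hrs
  have e2 : 4 * r * (s + s) = 4 := by linear_combination 4 * hrs
  rw [energy_ellipticMap r (by positivity) (by linarith), energy_ellipticMap r h0 h0, e1, e2,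
    mul_div_assoc, mul_div_assoc]
  refine mul_lt_mul_of_pos_left ?_ bumpIntegral_pos
  rw [div_lt_div_iff₀ (mul_pos (by positivity) (by linarith)) (by positivity)]
  -- After clearing denominators, the two sides differ by `2 δ² (1 - 4 s²)`.
  have h4 : 0 < δ ^ 2 * (1 - 4 * s ^ 2) := by
    have : 4 * s ^ 2 < 1 := by nlinarith
    have : 0 < 1 - 4 * s ^ 2 := by linarith
    positivity
  nlinarith

theorem skyrmion_unstable {r : ℝ} (hr : 1 < r) :
    ∃ h : M4, h.map = skyrmion (2 * r) ∧
      ∀ U ∈ 𝓝 h, ∃ n ∈ U, energy r n.map - energy r h.map < 0 := by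
  obtain ⟨s, hs⟩ : ∃ s, s = (2 * r)⁻¹ := ⟨_, rfl⟩
  have h0 : 0 < s := by rw [hs]; positivity
  refine ⟨ellipticM4 h0 h0, by rw [skyrmion_eq_ellipticMap, ← hs]; rfl, fun U hU => ?_⟩
  obtain ⟨δ, hδ, hlim⟩ : ∃ δ : ℕ → ℝ, (∀ k, δ k ∈ Set.Ioc 0 (s / 2)) ∧
      Tendsto δ atTop (𝓝 0) := by
    refine ⟨fun k => s / 2 * (1 / ((k : ℝ) + 1)), fun k => ⟨by positivity, ?_⟩, ?_⟩
    · refine mul_le_of_le_one_right (by positivity) ?_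
      rw [div_le_one (by positivity)]
      linarith [(k.cast_nonneg : (0 : ℝ) ≤ k)]
    · simpa using (tendsto_one_div_add_atTop_nhds_zero_nat (𝕜 := ℝ)).const_mul (s / 2)
  have ha : ∀ k, 0 < s + δ k := fun k => by linarith [(hδ k).1]
  have hb : ∀ k, 0 < s - δ k := fun k => by linarith [(hδ k).2]
  have ht := tendsto_ellipticM4 (m := s / 2) (M := 2 * s) h0 ha hb (by positivity)
    (fun k => ⟨by linarith [(hδ k).1], by linarith [(hδ k).2]⟩)
    (fun k => ⟨by linarith [(hδ k).2], by linarith [(hδ k).1]⟩)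
    (by simpa using hlim.const_add s) (by simpa using hlim.const_sub s)
  obtain ⟨k, hk⟩ := (ht.eventually hU).exists
  exact ⟨_, hk, sub_neg.2 (energy_ellipticMap_lt hr hs (hδ k).1 (by linarith [(hδ k).2]))⟩

/-! ### The first variation at the skyrmion -/

theorem helicityForm_add_left (w u : Space3) (G : Grad) :
    helicityForm (w + u) G = helicityForm w G + helicityForm u G := by
  simp [helicityForm]
  ring

theorem helicityForm_add_right (w : Space3) (G g : Grad) :
    helicityForm w (G + g) = helicityForm w G + helicityForm w g := by
  simp [helicityForm]
  ring

theorem abs_helicityForm_le (w : Space3) (G : Grad) : |helicityForm w G| ≤ 4 * ‖w‖ * ‖G‖ := by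
  have h : ∀ i k j, |w i * G j k| ≤ ‖w‖ * ‖G‖ := fun i k j => by
    rw [abs_mul]
    exact mul_le_mul (PiLp.norm_apply_le w i)
      ((PiLp.norm_apply_le (G j) k).trans (PiLp.norm_apply_le G j)) (abs_nonneg _) (norm_nonneg _)
  have h1 := abs_le.1 (h 0 2 1)
  have h2 := abs_le.1 (h 1 2 0)
  have h3 := abs_le.1 (h 2 1 0)
  have h4 := abs_le.1 (h 2 0 1)
  rw [helicityForm, abs_le]
  constructor <;> linarith [h1.1, h1.2, h2.1, h2.2, h3.1, h3.2, h4.1, h4.2]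

/-- The part of `energyDensity r (v + u) (V + g)` that is linear in `(u, g)`. -/
def firstVariation (r : ℝ) (v : Space3) (V : Grad) (u : Space3) (g : Grad) : ℝ :=
  inner ℝ V g + r * (helicityForm (v - e3) g + helicityForm u V) +
    (1 / 2) * ‖v - e3‖ ^ 2 * inner ℝ (v - e3) u

theorem energyDensity_add (r : ℝ) (v u : Space3) (V g : Grad) :
    energyDensity r (v + u) (V + g) = energyDensity r v V + firstVariation r v V u g +
      ((1 / 2) * ‖g‖ ^ 2 + r * helicityForm u g + (1 / 4) * ‖v - e3‖ ^ 2 * ‖u‖ ^ 2 +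
        (1 / 8) * (2 * inner ℝ (v - e3) u + ‖u‖ ^ 2) ^ 2) := by
  have h1 : ‖v + u - e3‖ ^ 4 = (‖v - e3‖ ^ 2 + 2 * inner ℝ (v - e3) u + ‖u‖ ^ 2) ^ 2 := by
    rw [← norm_add_sq_real, add_sub_right_comm]
    ring
  rw [energyDensity, energyDensity, firstVariation, h1, norm_add_sq_real, add_sub_right_comm,
    helicityForm_add_left, helicityForm_add_right, helicityForm_add_right]
  ring

theorem abs_energyDensity_add_sub_le {r : ℝ} (hr : 0 ≤ r) {v u : Space3} (V g : Grad)
    (hv : ‖v‖ = 1) (hvu : ‖v + u‖ = 1) :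
    |energyDensity r (v + u) (V + g) - energyDensity r v V - firstVariation r v V u g| ≤
      (2 * r + 6) * (‖u‖ ^ 2 + ‖g‖ ^ 2) := by
  have he : ‖e3‖ = 1 := by
    rw [← sq_eq_sq₀ (norm_nonneg _) one_pos.le, EuclideanSpace.real_norm_sq_eq]
    simp [e3, Fin.sum_univ_three]
  have hm : ‖v - e3‖ ≤ 2 := (norm_sub_le _ _).trans (by rw [hv, he]; norm_num)
  have hu : ‖u‖ ≤ 2 := by
    have := norm_sub_le (v + u) v
    rw [add_sub_cancel_left, hv, hvu] at this
    linarith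
  have hi : |inner ℝ (v - e3) u| ≤ 2 * ‖u‖ :=
    (abs_real_inner_le_norm _ _).trans (by gcongr)
  have hq : (2 * inner ℝ (v - e3) u + ‖u‖ ^ 2) ^ 2 ≤ (6 * ‖u‖) ^ 2 := by
    rw [sq_le_sq, abs_of_nonneg (by positivity : 0 ≤ 6 * ‖u‖), abs_le]
    have := abs_le.1 hi
    have : ‖u‖ ^ 2 ≤ 2 * ‖u‖ := by nlinarith [norm_nonneg u]
    constructor <;> nlinarith [norm_nonneg u, sq_nonneg ‖u‖]
  have hh : |r * helicityForm u g| ≤ r * (2 * (‖u‖ ^ 2 + ‖g‖ ^ 2)) := by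
    rw [abs_mul, abs_of_nonneg hr]
    gcongr
    refine (abs_helicityForm_le u g).trans ?_
    nlinarith [sq_nonneg (‖u‖ - ‖g‖)]
  have hm2 : ‖v - e3‖ ^ 2 * ‖u‖ ^ 2 ≤ 2 ^ 2 * ‖u‖ ^ 2 := by gcongr
  have hm3 : 0 ≤ ‖v - e3‖ ^ 2 * ‖u‖ ^ 2 := by positivity
  have hh' := abs_le.1 hh
  rw [energyDensity_add, abs_le]
  constructor <;>
    nlinarith [sq_nonneg (2 * inner ℝ (v - e3) u + ‖u‖ ^ 2), sq_nonneg ‖u‖, sq_nonneg ‖g‖]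

/-- The vector fields `F₁`, `F₂` dual to `∂₁u`, `∂₂u` in the first variation at the skyrmion
`n = h(s x)`, namely `Fᵢ = ∂ᵢn + r (n - e₃) × eᵢ` with `r = 1 / (2s)`. -/
def flux (r s : ℝ) (i : Fin 2) (x : Plane) : Space3 :=
  if i = 0 then
    !₂[4 * s ^ 3 * x 0 * x 1 * ellipticBump s s x ^ 2,
      (2 * s - 2 * r) * ellipticBump s s x - 4 * s ^ 3 * x 0 ^ 2 * ellipticBump s s x ^ 2,
      4 * s ^ 2 * x 0 * ellipticBump s s x ^ 2 - x 0 * ellipticBump s s x]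
  else
    !₂[(2 * r - 2 * s) * ellipticBump s s x + 4 * s ^ 3 * x 1 ^ 2 * ellipticBump s s x ^ 2,
      -(4 * s ^ 3 * x 0 * x 1 * ellipticBump s s x ^ 2),
      4 * s ^ 2 * x 1 * ellipticBump s s x ^ 2 - x 1 * ellipticBump s s x]

theorem contDiff_flux (r s : ℝ) (i : Fin 2) : ContDiff ℝ ∞ (flux r s i) := by
  rw [contDiff_euclidean]
  intro k
  fin_cases i <;> fin_cases k <;> simp [flux] <;> fun_prop

/-- The Euler–Lagrange equation of the skyrmion: up to the multiple `|∇n|² n` of `n`, the first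
variation is the divergence of the field `i ↦ Fᵢ · u`. -/
theorem firstVariation_skyrmion {r s : ℝ} (hrs : 2 * r * s = 1) (x : Plane) (u : Space3)
    (g : Grad) :
    firstVariation r (ellipticMap s s x) (classicalGrad (ellipticMap s s) x) u g =
      ∑ i, (inner ℝ (flux r s i x) (g i) +
        inner ℝ (fderiv ℝ (flux r s i) x (EuclideanSpace.single i 1)) u) +
      8 * s ^ 2 * ellipticBump s s x ^ 2 * inner ℝ (ellipticMap s s x) u := by
  have hd : ∀ i, DifferentiableAt ℝ (flux r s i) x := fun i =>
    (contDiff_flux r s i).differentiable (by simp) x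
  have h := ellipticBump_mul s s x
  rw [firstVariation, norm_ellipticMap_sub_e3]
  simp only [PiLp.inner_apply, Fin.sum_univ_two, Fin.sum_univ_three, fderiv_space3_apply (hd _),
    classicalGrad_apply, fderiv_ellipticMap, helicityForm]
  simp (disch := fun_prop) [flux, ellipticMap, e3, fderiv_fun_mul, fderiv_fun_pow, fderiv_coord,
    fderiv_fun_sub, fderiv_fun_add, fderiv_ellipticBump]
  generalize ellipticBump s s x = q at *
  generalize x 0 = X at *
  generalize x 1 = Y at *
  linear_combination (-X * q * g.ofLp 0 2 - Y * q * g.ofLp 1 2 + 4 * s * Y * q ^ 2 * u 0 -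
      4 * s * X * q ^ 2 * u 1 + 2 * q ^ 2 * u 2) * hrs +
    (16 * s ^ 3 * Y * q ^ 2 * u 0 - 16 * s ^ 3 * X * q ^ 2 * u 1 +
      (16 * s ^ 2 * q ^ 2 - 4 * r * s * q - 2 * q) * u 2) * h

theorem integral_inner_fderiv_add_eq_zero {F u : Plane → Space3} (hF : ContDiff ℝ 1 F)
    (hu : ContDiff ℝ 1 u) (hc : HasCompactSupport u) (v : Plane) :
    ∫ x, (inner ℝ (F x) (fderiv ℝ u x v) + inner ℝ (fderiv ℝ F x v) (u x)) = 0 := by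
  have hF' := hF.continuous_fderiv one_ne_zero
  have hu' := hu.continuous_fderiv one_ne_zero
  have hFc := hF.continuous
  have huc := hu.continuous
  have h1 : Integrable fun x => inner ℝ (F x) (fderiv ℝ u x v) :=
    Continuous.integrable_of_hasCompactSupport (by fun_prop)
      (HasCompactSupport.intro hc fun x hx => by simp [fderiv_of_notMem_tsupport ℝ hx])
  have h2 : Integrable fun x => inner ℝ (fderiv ℝ F x v) (u x) :=
    Continuous.integrable_of_hasCompactSupport (by fun_prop)
      (HasCompactSupport.intro hc fun x hx => by simp [image_eq_zero_of_notMem_tsupport hx])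
  have h3 : Integrable fun x => inner ℝ (F x) (u x) :=
    Continuous.integrable_of_hasCompactSupport (by fun_prop)
      (HasCompactSupport.intro hc fun x hx => by simp [image_eq_zero_of_notMem_tsupport hx])
  rw [integral_add h1 h2]
  have := integral_bilinear_fderiv_right_eq_neg_left_of_integrable (B := innerSL ℝ)
    (f := F) (g := u) (v := v) (μ := volume) h2 h1 h3
    (fun _ _ => hF.differentiable one_ne_zero _) (fun _ _ => hu.differentiable one_ne_zero _)
  exact eq_neg_iff_add_eq_zero.1 this

theorem classicalGrad_add {n u : Plane → Space3} (hn : ContDiff ℝ 1 n) (hu : ContDiff ℝ 1 u)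
    (x : Plane) : classicalGrad (n + u) x = classicalGrad n x + classicalGrad u x := by
  ext i : 1
  simp only [classicalGrad_apply, PiLp.add_apply]
  rw [fderiv_add (hn.differentiable one_ne_zero x) (hu.differentiable one_ne_zero x)]
  rfl

theorem classicalGrad_eq_zero {u : Plane → Space3} {x : Plane} (hx : x ∉ tsupport u) :
    classicalGrad u x = 0 := by
  ext i : 1
  rw [classicalGrad_apply, fderiv_of_notMem_tsupport ℝ hx]
  rfl

theorem integrable_of_eq_off_compact {f g : Plane → ℝ} (hf : Integrable f) (hfc : Continuous f)
    (hgc : Continuous g) {K : Set Plane} (hK : IsCompact K) (h : ∀ x ∉ K, g x = f x) :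
    Integrable g := by
  have h1 : Integrable (fun x => g x - f x) :=
    (hgc.sub hfc).integrable_of_hasCompactSupport
      (HasCompactSupport.intro hK fun x hx => sub_eq_zero.2 (h x hx))
  exact (h1.add hf).congr (.of_forall fun x => sub_add_cancel (g x) (f x))

theorem continuous_helicityForm {n : Plane → Space3} (hn : ContDiff ℝ 1 n) :
    Continuous fun x => helicityForm (n x - e3) (classicalGrad n x) := by
  have h1 := hn.continuous
  have h2 := continuous_classicalGrad hn
  unfold helicityForm
  fun_prop

/-- A compactly supported change of a sphere-valued map moves its energy by the first variation up
to an error that is quadratic in the change and its gradient. -/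
theorem abs_energy_add_sub_le {r s : ℝ} (hr : 0 < r) (hrs : 2 * r * s = 1) {u : Plane → Space3}
    (hu : ContDiff ℝ 1 u) (hc : HasCompactSupport u)
    (hsphere : ∀ x, ‖ellipticMap s s x + u x‖ = 1) :
    |energy r (ellipticMap s s + u) - energy r (ellipticMap s s)| ≤
      (2 * r + 6 + 4 * s ^ 2) * ∫ x, (‖u x‖ ^ 2 + ‖classicalGrad u x‖ ^ 2) := by
  have hs : 0 < s := by
    by_contra! h
    nlinarith
  have hn : ContDiff ℝ 1 (ellipticMap s s) := (contDiff_ellipticMap s s).of_le (by simp)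
  have hnu : ContDiff ℝ 1 (ellipticMap s s + u) := hn.add hu
  have hnc := hn.continuous
  have hnuc := hnu.continuous
  have hng := continuous_classicalGrad hn
  have hnug := continuous_classicalGrad hnu
  have huc := hu.continuous
  have hug := continuous_classicalGrad hu
  have hoff : ∀ x ∉ tsupport u, (ellipticMap s s + u) x = ellipticMap s s x ∧
      classicalGrad (ellipticMap s s + u) x = classicalGrad (ellipticMap s s) x := by
    intro x hx
    rw [classicalGrad_add hn hu, classicalGrad_eq_zero hx]
    simp [image_eq_zero_of_notMem_tsupport hx]
  have hD := integrable_norm_classicalGrad_ellipticMap hs hs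
  have hH := integrable_helicityForm_ellipticMap hs hs
  have hV := integrable_norm_ellipticMap_sub_e3 hs hs
  have hD' : Integrable fun x => ‖classicalGrad (ellipticMap s s + u) x‖ ^ 2 :=
    integrable_of_eq_off_compact hD (by fun_prop) (by fun_prop) hc
      fun x hx => by rw [(hoff x hx).2]
  have hH' : Integrable fun x => helicityForm ((ellipticMap s s + u) x - e3)
      (classicalGrad (ellipticMap s s + u) x) :=
    integrable_of_eq_off_compact hH (continuous_helicityForm hn) (continuous_helicityForm hnu) hc
      fun x hx => by rw [(hoff x hx).1, (hoff x hx).2]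
  have hV' : Integrable fun x => ‖(ellipticMap s s + u) x - e3‖ ^ 4 :=
    integrable_of_eq_off_compact hV (by fun_prop) (by fun_prop) hc
      fun x hx => by rw [(hoff x hx).1]
  have hE : Integrable fun x => energyDensity r (ellipticMap s s x)
      (classicalGrad (ellipticMap s s) x) :=
    ((hD.const_mul _).add (hH.const_mul _)).add (hV.const_mul _)
  have hE' : Integrable fun x => energyDensity r ((ellipticMap s s + u) x)
      (classicalGrad (ellipticMap s s + u) x) :=
    ((hD'.const_mul _).add (hH'.const_mul _)).add (hV'.const_mul _)
  have hEE : Integrable fun x => energyDensity r ((ellipticMap s s + u) x)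
      (classicalGrad (ellipticMap s s + u) x) - energyDensity r (ellipticMap s s x)
      (classicalGrad (ellipticMap s s) x) := hE'.sub hE
  -- The divergence of `i ↦ Fᵢ · u`, which integrates to zero.
  have hdiv_int : ∀ i, Integrable fun x =>
      inner ℝ (flux r s i x) (classicalGrad u x i) +
        inner ℝ (fderiv ℝ (flux r s i) x (EuclideanSpace.single i 1)) (u x) := by
    intro i
    have hf := (contDiff_flux r s i).continuous
    have hf' := (contDiff_flux r s i).continuous_fderiv (by simp)
    refine Continuous.integrable_of_hasCompactSupport (by fun_prop)
      (HasCompactSupport.intro hc fun x hx => ?_)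
    simp [classicalGrad_eq_zero hx, image_eq_zero_of_notMem_tsupport hx]
  have hdiv : ∫ x, ∑ i, (inner ℝ (flux r s i x) (classicalGrad u x i) +
      inner ℝ (fderiv ℝ (flux r s i) x (EuclideanSpace.single i 1)) (u x)) = 0 := by
    rw [integral_finsetSum _ fun i _ => hdiv_int i]
    exact Finset.sum_eq_zero fun i _ => integral_inner_fderiv_add_eq_zero
      ((contDiff_flux r s i).of_le (by simp)) hu hc _
  have hint : Integrable fun x => ‖u x‖ ^ 2 + ‖classicalGrad u x‖ ^ 2 := by
    refine Continuous.integrable_of_hasCompactSupport (by fun_prop)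
      (HasCompactSupport.intro hc fun x hx => ?_)
    simp [classicalGrad_eq_zero hx, image_eq_zero_of_notMem_tsupport hx]
  rw [energy_eq_integral hnu hD' hH' hV', energy_eq_integral hn hD hH hV, ← integral_sub hE' hE,
    ← sub_zero (∫ x, _), ← hdiv,
    ← integral_sub hEE (integrable_finsetSum _ fun i _ => hdiv_int i),
    ← integral_const_mul, ← Real.norm_eq_abs]
  refine norm_integral_le_of_norm_le (hint.const_mul _) (.of_forall fun x => ?_)
  have h1 := abs_energyDensity_add_sub_le hr.le (classicalGrad (ellipticMap s s) x)
    (classicalGrad u x) (norm_ellipticMap s s x) (hsphere x)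
  rw [firstVariation_skyrmion hrs, ← classicalGrad_add hn hu] at h1
  -- On the sphere, `n · u = -|u|² / 2`, so that the multiple of `n` contributes quadratically.
  have h2 : inner ℝ (ellipticMap s s x) (u x) = -(1 / 2) * ‖u x‖ ^ 2 := by
    have := norm_add_sq_real (ellipticMap s s x) (u x)
    rw [hsphere, norm_ellipticMap] at this
    linarith
  have hq0 := ellipticBump_pos s s x
  have hq1 : ellipticBump s s x ≤ 1 := by
    refine inv_le_one_of_one_le₀ ?_
    nlinarith [sq_nonneg (s * x 0), sq_nonneg (s * x 1)]
  have h3 : s ^ 2 * ellipticBump s s x ^ 2 * ‖u x‖ ^ 2 ≤ s ^ 2 * 1 ^ 2 * ‖u x‖ ^ 2 := by gcongr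
  have h4 : 0 ≤ s ^ 2 * ellipticBump s s x ^ 2 * ‖u x‖ ^ 2 := by positivity
  have h5 : 0 ≤ s ^ 2 * ‖classicalGrad u x‖ ^ 2 := by positivity
  rw [h2] at h1
  rw [Real.norm_eq_abs, abs_le]
  have h6 := abs_le.1 h1
  simp only [Pi.add_apply] at h6 ⊢
  constructor <;> linarith [h6.1, h6.2]

/-! ### Criticality of the skyrmion -/

/-- A function that is `C¹` near a compact convex box is Lipschitz in the time variable there. -/
theorem exists_norm_sub_le_of_contDiffAt {E : Type*} [NormedAddCommGroup E] [NormedSpace ℝ E]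
    {F : ℝ × Plane → E} {t₀ R : ℝ} (ht₀ : 0 ≤ t₀)
    (hF : ∀ t x, |t| ≤ t₀ → ContDiffAt ℝ 1 F (t, x)) :
    ∃ C, 0 ≤ C ∧ ∀ t x, |t| ≤ t₀ → ‖x‖ ≤ R → ‖F (t, x) - F (0, x)‖ ≤ C * |t| := by
  set K : Set (ℝ × Plane) := Metric.closedBall 0 t₀ ×ˢ Metric.closedBall 0 R
  have hK : IsCompact K := (isCompact_closedBall _ _).prod (isCompact_closedBall _ _)
  have hKc : Convex ℝ K := (convex_closedBall _ _).prod (convex_closedBall _ _)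
  have hF' : ∀ p ∈ K, ContDiffAt ℝ 1 F p := fun p hp => hF p.1 p.2 (by simpa using hp.1)
  have hcont : ContinuousOn (fderiv ℝ F) K := fun p hp =>
    ((hF' p hp).fderiv_right (m := 0) (by simp)).continuousAt.continuousWithinAt
  obtain ⟨C, hC⟩ := hK.exists_bound_of_continuousOn hcont
  refine ⟨max C 0, le_max_right _ _, fun t x ht hx => ?_⟩
  have h := hKc.norm_image_sub_le_of_norm_fderiv_le (𝕜 := ℝ) (f := F) (x := (0, x)) (y := (t, x))
    (fun p hp => (hF' p hp).differentiableAt one_ne_zero)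
    (fun p hp => (hC p hp).trans (le_max_left C 0))
    (by simpa [K] using And.intro ht₀ hx) (by simpa [K] using And.intro ht hx)
  simpa using h

/-- The change `(n + tφ) / |n + tφ| - n` of the sphere-valued map `n` in a variation. -/
def variationChange (n φ : Plane → Space3) (t : ℝ) (x : Plane) : Space3 :=
  ‖n x + t • φ x‖⁻¹ • (n x + t • φ x) - n x

theorem variationChange_zero {n φ : Plane → Space3} (hn : ∀ x, ‖n x‖ = 1) (x : Plane) :
    variationChange n φ 0 x = 0 := by
  simp [variationChange, hn]

theorem tsupport_variationChange_subset {n φ : Plane → Space3} (hn : ∀ x, ‖n x‖ = 1) (t : ℝ) :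
    tsupport (variationChange n φ t) ⊆ tsupport φ := by
  refine closure_mono fun x hx => ?_
  contrapose! hx
  simp only [Function.mem_support, not_not] at hx ⊢
  simp [variationChange, hn, hx]

/-- In a variation of a smooth sphere-valued map, the map and its gradient change by `O(t)`,
uniformly in space. -/
theorem exists_variationChange_le {n φ : Plane → Space3} (hn : ContDiff ℝ ∞ n)
    (hn1 : ∀ x, ‖n x‖ = 1) (hφ : ContDiff ℝ ∞ φ) (hc : HasCompactSupport φ) :
    ∃ t₀ > 0, ∃ C, 0 ≤ C ∧ ∀ t, |t| ≤ t₀ →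
      (∀ x, n x + t • φ x ≠ 0) ∧ ContDiff ℝ 1 (variationChange n φ t) ∧
      ∀ x, ‖variationChange n φ t x‖ ≤ C * |t| ∧
        ‖classicalGrad (variationChange n φ t) x‖ ≤ C * |t| := by
  obtain ⟨M, hM⟩ := hφ.continuous.bounded_above_of_compact_support hc
  have hM0 : 0 ≤ M := (norm_nonneg _).trans (hM 0)
  obtain ⟨R, hR⟩ := hc.isCompact.isBounded.exists_norm_le
  set t₀ : ℝ := 1 / (2 * (M + 1))
  have ht₀ : 0 < t₀ := by positivity
  have hne : ∀ t x, |t| ≤ t₀ → n x + t • φ x ≠ 0 := by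
    intro t x ht h0
    have h1 : ‖t • φ x‖ ≤ t₀ * M := by
      rw [norm_smul]
      exact mul_le_mul ht (hM x) (norm_nonneg _) ht₀.le
    have h2 : t₀ * M < 1 := by
      rw [div_mul_eq_mul_div, div_lt_one (by positivity)]
      linarith
    rw [eq_neg_of_add_eq_zero_right h0, norm_neg, hn1] at h1
    linarith
  -- Treating `t` as a variable makes both estimates instances of the Lipschitz bound.
  let F : ℝ × Plane → Space3 := fun p => variationChange n φ p.1 p.2
  have hF : ∀ t x, |t| ≤ t₀ → ContDiffAt ℝ ∞ F (t, x) := by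
    intro t x ht
    have h1 : ContDiffAt ℝ ∞ (fun p : ℝ × Plane => n p.2 + p.1 • φ p.2) (t, x) := by fun_prop
    have h2 : ContDiffAt ℝ ∞ (fun p : ℝ × Plane => n p.2) (t, x) := by fun_prop
    exact ((((h1.norm ℝ (hne t x ht)).inv (norm_ne_zero_iff.2 (hne t x ht))).smul h1).sub h2)
  obtain ⟨C₁, hC₁, hb₁⟩ := exists_norm_sub_le_of_contDiffAt (F := F) (R := R) ht₀.le
    fun t x ht => (hF t x ht).of_le (by simp)
  obtain ⟨C₂, hC₂, hb₂⟩ := exists_norm_sub_le_of_contDiffAt (F := fderiv ℝ F) (R := R) ht₀.le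
    fun t x ht => (hF t x ht).fderiv_right (m := 1)
      (by norm_num; exact WithTop.coe_le_coe.2 le_top)
  have hslice : ∀ t x v, |t| ≤ t₀ →
      fderiv ℝ (variationChange n φ t) x v = fderiv ℝ F (t, x) (0, v) := by
    intro t x v ht
    have h := (((hF t x ht).differentiableAt (by simp)).hasFDerivAt.comp x
      (hasFDerivAt_prodMk_right t x)).fderiv
    exact congrArg (fun L : Plane →L[ℝ] Space3 => L v) h
  have h0 : variationChange n φ 0 = 0 := funext (variationChange_zero hn1)
  have hgrad : ∀ t x, |t| ≤ t₀ → ‖x‖ ≤ R →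
      ‖classicalGrad (variationChange n φ t) x‖ ≤ 2 * C₂ * |t| := by
    intro t x ht hx
    have hi : ∀ i, ‖classicalGrad (variationChange n φ t) x i‖ ≤ C₂ * |t| := by
      intro i
      have h1 : fderiv ℝ F (0, x) (0, EuclideanSpace.single i 1) = 0 := by
        rw [← hslice 0 x _ (by simpa using ht₀.le), h0]
        simp
      rw [classicalGrad_apply, hslice t x _ ht, ← sub_zero (fderiv ℝ F (t, x) _), ← h1,
        ← sub_apply]
      refine (ContinuousLinearMap.le_opNorm _ _).trans ?_
      rw [Prod.norm_mk]
      simpa using hb₂ t x ht hx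
    have h2 : 0 ≤ C₂ * |t| := by positivity
    refine (sq_le_sq₀ (norm_nonneg _) (by positivity)).1 ?_
    rw [PiLp.norm_sq_eq_of_L2, Fin.sum_univ_two]
    have h3 := pow_le_pow_left₀ (norm_nonneg _) (hi 0) 2
    have h4 := pow_le_pow_left₀ (norm_nonneg _) (hi 1) 2
    nlinarith
  refine ⟨t₀, ht₀, max C₁ (2 * C₂), le_max_of_le_left hC₁, fun t ht => ⟨fun x => hne t x ht, ?_, ?_⟩⟩
  · rw [contDiff_iff_contDiffAt]
    intro x
    exact ((hF t x ht).of_le (by simp)).comp x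
      (contDiffAt_const.prodMk contDiffAt_id : ContDiffAt ℝ 1 (fun y : Plane => (t, y)) x)
  · intro x
    by_cases hx : x ∈ tsupport φ
    · have hxR := hR x hx
      constructor
      · have := hb₁ t x ht hxR
        simp only [F, variationChange_zero hn1, sub_zero] at this
        exact this.trans (by gcongr; exact le_max_left _ _)
      · exact (hgrad t x ht hxR).trans (by gcongr; exact le_max_right _ _)
    · have hx' : x ∉ tsupport (variationChange n φ t) := fun h =>
        hx (tsupport_variationChange_subset hn1 t h)
      rw [image_eq_zero_of_notMem_tsupport hx', classicalGrad_eq_zero hx']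
      have : 0 ≤ max C₁ (2 * C₂) := le_max_of_le_left hC₁
      constructor <;> · rw [norm_zero]; positivity

theorem isCriticalPoint_ellipticMap {r s : ℝ} (hr : 0 < r) (hrs : 2 * r * s = 1) :
    IsCriticalPoint r (ellipticMap s s) := by
  intro φ hφ hc
  obtain ⟨t₀, ht₀, C, hC, hb⟩ := exists_variationChange_le (contDiff_ellipticMap s s)
    (norm_ellipticMap s s) hφ hc
  have hsum : ∀ t, (fun x => ‖ellipticMap s s x + t • φ x‖⁻¹ • (ellipticMap s s x + t • φ x)) =
      ellipticMap s s + variationChange (ellipticMap s s) φ t := by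
    intro t
    funext x
    simp [variationChange]
  have hzero : energy r (ellipticMap s s + variationChange (ellipticMap s s) φ 0) =
      energy r (ellipticMap s s) := by
    congr 1
    funext x
    simp [variationChange_zero (norm_ellipticMap s s)]
  simp_rw [hsum]
  -- The energy changes by `O(t²)`.
  set A : ℝ := (2 * r + 6 + 4 * s ^ 2) * (2 * C ^ 2 * volume.real (tsupport φ))
  have hA : ∀ t, |t| ≤ t₀ →
      |energy r (ellipticMap s s + variationChange (ellipticMap s s) φ t) -
        energy r (ellipticMap s s)| ≤ A * t ^ 2 := by
    intro t ht
    obtain ⟨hne, hu, hle⟩ := hb t ht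
    set u := variationChange (ellipticMap s s) φ t
    have hsub := tsupport_variationChange_subset (φ := φ) (norm_ellipticMap s s) t
    have hcu : HasCompactSupport u := hc.of_isClosed_subset (isClosed_tsupport _) hsub
    have hsphere : ∀ x, ‖ellipticMap s s x + u x‖ = 1 := fun x => by
      rw [← Pi.add_apply, ← congrFun (hsum t) x, norm_smul, norm_inv, norm_norm,
        inv_mul_cancel₀ (norm_ne_zero_iff.2 (hne x))]
    refine (abs_energy_add_sub_le hr hrs hu hcu hsphere).trans ?_
    have hint : ∫ x, (‖u x‖ ^ 2 + ‖classicalGrad u x‖ ^ 2) ≤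
        2 * C ^ 2 * t ^ 2 * volume.real (tsupport φ) := by
      rw [← setIntegral_eq_integral_of_forall_compl_eq_zero (s := tsupport φ) fun x hx => by
        have hx' : x ∉ tsupport u := fun h => hx (hsub h)
        simp [classicalGrad_eq_zero hx', image_eq_zero_of_notMem_tsupport hx']]
      refine (Real.le_norm_self _).trans
        (norm_setIntegral_le_of_norm_le_const hc.isCompact.measure_lt_top fun x _ => ?_)
      have h1 := pow_le_pow_left₀ (norm_nonneg _) (hle x).1 2
      have h2 := pow_le_pow_left₀ (norm_nonneg _) (hle x).2 2
      rw [mul_pow, sq_abs] at h1 h2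
      rw [Real.norm_of_nonneg (by positivity)]
      linarith
    calc _ ≤ (2 * r + 6 + 4 * s ^ 2) * (2 * C ^ 2 * t ^ 2 * volume.real (tsupport φ)) := by gcongr
      _ = A * t ^ 2 := by ring
  have hO : (fun t => energy r (ellipticMap s s + variationChange (ellipticMap s s) φ t) -
      energy r (ellipticMap s s)) =O[𝓝 0] fun t => ‖t - 0‖ ^ 2 := by
    refine Asymptotics.IsBigO.of_bound A ?_
    filter_upwards [Metric.closedBall_mem_nhds (0 : ℝ) ht₀] with t ht
    simpa using hA t (by simpa using ht)
  have hd := (hO.hasFDerivAt one_lt_two).hasDerivAt.add_const (energy r (ellipticMap s s))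
  simpa using hd

end

theorem theorem1 (r : ℝ) (hr : 1 < r) :
    IsCriticalPoint r (skyrmion (2 * r)) ∧
    ∃ h : M4, h.map = skyrmion (2 * r) ∧
      ∀ U ∈ 𝓝 h, ∃ n ∈ U, energy r n.map - energy r h.map < 0 := by
  refine ⟨?_, skyrmion_unstable hr⟩
  rw [skyrmion_eq_ellipticMap]
  exact isCriticalPoint_ellipticMap (by positivity) (mul_inv_cancel₀ (by positivity))
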